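/- Let $\lambda$ be a partition of $N$. A filling of the Young diagram of $\lambda$ assigns positive integers to its boxes; it is row-standard (column-standard) if the entries strictly increase from left to right along rows (from top to bottom down columns). An inverted standard Young tableau of shape $\lambda$ is a row-standard filling in which each of $1,\dots,N$ is used exactly once; a standard Young tableau is one that is also column-standard. An inversion pair $(i,j)$ of such a filling $\tau$ is a pair of entries $i<j$ of the same column for which, writing $i_k,j_k$ for the entries $k$ boxes to the right of $i,j$, there is $n\ge 0$ such that $i_k,j_k$ exist and $i_k=j_k$ for $1\le k\le n$, and either $i_{n+1}$ or $j_{n+1}$ does not exist and $i$ appears below $j$, or both exist and $i_{n+1}>j_{n+1}$. For a standard Young tableau $T$ of shape $\lambda$, let $S_k^T(\lambda)$ be the set of inverted standard Young tableaux of shape $\lambda$ that have exactly $k$ inversion pairs and from which $T$ is obtained by reordering the entries within each column, and let $$\chi^T(q)=\sum_{k\ge 0}|S_k^T(\lambda)|\,q^k .$$ **Corollary.** For every standard Young tableau $T$, the polynomial $\chi^T(q)$ is log-concave: writing $a_k=|S_k^T(\lambda)|$, one has $a_k^2\ge a_{k-1}a_{k+1}$ for all $k\ge 1$, and the sequence $(a_k)$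 has no internal zeros (if $i<j<k$ and $a_i,a_k\ne 0$, then $a_j\neq 0$). -/

import Mathlib

open scoped Polynomial

noncomputable section

namespace InvertedTableau

/-- A filling of the Young diagram `lam` (cell `(i, j)` is in row `i` from the top and column `j`
from the left, both counted from `0`): an assignment of positive integers to its cells in which
no integer is skipped. For extensionality the entry is `0` outside the diagram. -/
@[ext]
structure Filling (lam : YoungDiagram) where
  /-- The entry in row `i` and column `j`. -/
  entry : ℕ → ℕ → ℕ
  pos : ∀ {i j : ℕ}, (i, j) ∈ lam → 1 ≤ entry i j
  no_skip : ∀ {i j v : ℕ}, (i, j) ∈ lam → 1 ≤ v → v ≤ entry i j →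
    ∃ i' j', (i', j') ∈ lam ∧ entry i' j' = v
  zeros : ∀ {i j : ℕ}, (i, j) ∉ lam → entry i j = 0

namespace Filling

variable {lam : YoungDiagram}

/-- Entries increase strictly from left to right along each row. -/
def IsRowStandard (t : Filling lam) : Prop :=
  ∀ i j j' : ℕ, j < j' → (i, j') ∈ lam → t.entry i j < t.entry i j'

/-- Entries increase strictly from top to bottom down each column. -/
def IsColStandard (t : Filling lam) : Prop :=
  ∀ i i' j : ℕ, i < i' → (i', j) ∈ lam → t.entry i j < t.entry i' j

/-- The content: the number of cells with entry `v`. -/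
def content (t : Filling lam) (v : ℕ) : ℕ :=
  (lam.cells.filter fun c => t.entry c.1 c.2 = v).card

/-- The content is `1¹ 2¹ ⋯ N¹`, where `N` is the number of cells. -/
def HasStandardContent (t : Filling lam) : Prop :=
  ∀ v ∈ Finset.Icc 1 lam.card, t.content v = 1

/-- `T` is a standard Young tableau of shape `lam`. -/
def IsStandardTableau (t : Filling lam) : Prop :=
  t.IsRowStandard ∧ t.IsColStandard ∧ t.HasStandardContent

/-- The entries `a` in cell `c` and `b` in cell `d` form an inversion pair `(a, b)`: the two cells
lie in the same column, `a < b`, and, for some `n ≥ 0`, the entries `k` boxes to the right of `a`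
and of `b` exist and agree for `1 ≤ k ≤ n`, while either one of the two entries `n + 1` boxes to
the right does not exist and `a` appears below `b`, or both exist and the one to the right of `a`
is larger than the one to the right of `b`. -/
def IsInversionPair (t : Filling lam) (c d : ℕ × ℕ) : Prop :=
  c ∈ lam ∧ d ∈ lam ∧ c.2 = d.2 ∧ t.entry c.1 c.2 < t.entry d.1 d.2 ∧
  ∃ n : ℕ,
    (∀ k ∈ Finset.Icc 1 n, (c.1, c.2 + k) ∈ lam ∧ (d.1, d.2 + k) ∈ lam ∧
      t.entry c.1 (c.2 + k) = t.entry d.1 (d.2 + k)) ∧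
    ((((c.1, c.2 + (n + 1)) ∉ lam ∨ (d.1, d.2 + (n + 1)) ∉ lam) ∧ d.1 < c.1) ∨
      ((c.1, c.2 + (n + 1)) ∈ lam ∧ (d.1, d.2 + (n + 1)) ∈ lam ∧
        t.entry d.1 (d.2 + (n + 1)) < t.entry c.1 (c.2 + (n + 1))))

open Classical in
/-- The number of inversion pairs, counted with multiplicity (as pairs of cells). -/
def inv (t : Filling lam) : ℕ :=
  ((lam.cells ×ˢ lam.cells).filter fun p => t.IsInversionPair p.1 p.2).card

open Classical in
theorem inv_le (t : Filling lam) : t.inv ≤ lam.card * lam.card := by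
  unfold inv
  exact (Finset.card_filter_le _ _).trans (Finset.card_product _ _).le

/-- The multiset of entries in column `j`. -/
def colEntries (t : Filling lam) (j : ℕ) : Multiset ℕ :=
  (lam.col j).val.map fun c => t.entry c.1 c.2

/-- `st(t) = T`: the filling `T` is column-standard and is obtained from `t` by reordering the
entries within each column. -/
def HasStandardization (t T : Filling lam) : Prop :=
  T.IsColStandard ∧ ∀ j : ℕ, t.colEntries j = T.colEntries j

end Filling

/-- The set `S_k(lam)` of `k`-inverted standard Young tableaux of shape `lam`. -/
def invertedTableaux (lam : YoungDiagram) (k : ℕ) : Set (Filling lam) :=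
  {t | t.IsRowStandard ∧ t.HasStandardContent ∧ t.inv = k}

/-- The set `S_k^T(lam)` of `k`-inverted standard Young tableaux with standardization `T`. -/
def invertedTableauxOver {lam : YoungDiagram} (T : Filling lam) (k : ℕ) : Set (Filling lam) :=
  {t | t ∈ invertedTableaux lam k ∧ t.HasStandardization T}

theorem finite_invertedTableauxOver {lam : YoungDiagram} (T : Filling lam) (k : ℕ) :
    (invertedTableauxOver T k).Finite := by
  classical
  let B : Finset ℕ := lam.cells.image fun c => T.entry c.1 c.2
  have key : ∀ t ∈ invertedTableauxOver T k, ∀ c : lam.cells, t.entry c.1.1 c.1.2 ∈ B := by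
    rintro t ⟨_, _, h⟩ ⟨⟨i, j⟩, hc⟩
    have h1 : t.entry i j ∈ t.colEntries j :=
      Multiset.mem_map.2 ⟨(i, j), YoungDiagram.mk_mem_col_iff.2 hc, rfl⟩
    rw [h j] at h1
    obtain ⟨d, hd, he⟩ := Multiset.mem_map.1 h1
    exact Finset.mem_image.2 ⟨d, (YoungDiagram.mem_col_iff.1 hd).1, he⟩
  let f : invertedTableauxOver T k → (lam.cells → B) := fun t c => ⟨_, key t.1 t.2 c⟩
  have hf : Function.Injective f := by
    rintro ⟨s, hs⟩ ⟨t, ht⟩ h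
    refine Subtype.ext (Filling.ext (funext fun i => funext fun j => ?_))
    by_cases hc : (i, j) ∈ lam
    · exact congrArg Subtype.val (congrFun h ⟨(i, j), hc⟩)
    · rw [s.zeros hc, t.zeros hc]
  exact Set.finite_coe_iff.1 (Finite.of_injective f hf)

/-- The generating function `χ^T(q) = ∑_k |S_k^T(lam)| q^k`. A filling of `lam` has at most
`|lam|²` inversion pairs, so all terms with larger `k` vanish. -/
def chi {lam : YoungDiagram} (T : Filling lam) : ℕ[X] :=
  ∑ k ∈ Finset.range (lam.card * lam.card + 1),
    Polynomial.monomial k (invertedTableauxOver T k).ncard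

theorem coeff_chi {lam : YoungDiagram} (T : Filling lam) (k : ℕ) :
    (chi T).coeff k = (invertedTableauxOver T k).ncard := by
  simp only [chi, Polynomial.finsetSum_coeff, Polynomial.coeff_monomial, Finset.sum_ite_eq',
    Finset.mem_range]
  split_ifs with h
  · rfl
  · symm
    have : invertedTableauxOver T k = ∅ := by
      ext t
      simp only [Set.mem_empty_iff_false, iff_false]
      rintro ⟨⟨_, _, h3⟩, _⟩
      have := t.inv_le
      omega
    rw [this, Set.ncard_empty]

/-- A polynomial `∑ a_k q^k` with nonnegative integer coefficients is log-concave if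
`a_k² ≥ a_{k-1} a_{k+1}` for all `k ≥ 1` and the sequence `(a_k)` has no internal zeros. -/
def IsLogConcave (p : ℕ[X]) : Prop :=
  (∀ k : ℕ, p.coeff k * p.coeff (k + 2) ≤ p.coeff (k + 1) ^ 2) ∧
  (∀ i j k : ℕ, i < j → j < k → p.coeff i ≠ 0 → p.coeff k ≠ 0 → p.coeff j ≠ 0)

end InvertedTableau

end

/-! ### Total positivity of order two and products of `q`-integers. -/

namespace InvertedTableau

/-! A filling with standardization `T` is `T` with column `j` rearranged by a permutation `σ j`.
Entries within a column of `T` are distinct, so an inversion pair is decided one box to the right.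
If `σ (j + 1)` is extended by the identity past the end of column `j + 1`, the "appears below" rule
for missing boxes becomes the same comparison as for existing ones. Hence the inversion pairs in
column `j` are exactly the inversions of the relative permutation `σ j * (σ (j + 1))⁻¹`, and
row-standardness is also a condition on these relative permutations, one at a time
(`inv_permuteCols`, `isRowStandard_permuteCols`). They can be chosen independently, so `chi T` is a
product over columns (`chi_eq_prod_sum`).

Since columns increase, each factor runs over permutations `s` with `s p < h p` for a monotone bound
`h`. Choosing the values of `s` in order of position shows that it is a product of `q`-integers `[h
p - p]` (`sum_bounded_finPerm`). Multiplication by a `q`-integer is a sliding-window sum and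
preserves total positivity of order two (`IsTP2.windowSum`), which yields log-concavity and the
absence of internal zeros together. -/

/-- A sequence indexed by the integers is totally positive of order two:
`a (i - 1) * a (j + 1) ≤ a i * a j` for `i ≤ j`. -/
def IsTP2 (a : ℤ → ℕ) : Prop :=
  ∀ i j : ℤ, i ≤ j → a (i - 1) * a (j + 1) ≤ a i * a j

/-- Moving both indices inwards one step at a time never decreases the product. -/
theorem IsTP2.mul_le_of_nested {a : ℤ → ℕ} (ha : IsTP2 a) {i r s j : ℤ} (hr : i ≤ r)
    (hs : i ≤ s) (h : i + j = r + s) : a i * a j ≤ a r * a s := by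
  have key : ∀ (k : ℕ) (i j : ℤ), i + k ≤ j - k → a i * a j ≤ a (i + k) * a (j - k) := by
    intro k
    induction k with
    | zero => intro i j _; simp
    | succ k ih =>
      intro i j hij
      push_cast at hij ⊢
      refine (ih i j (by omega)).trans ?_
      have := ha (i + (k + 1)) (j - (k + 1)) hij
      rwa [show i + ((k : ℤ) + 1) - 1 = i + k by ring,
        show j - ((k : ℤ) + 1) + 1 = j - k by ring] at this
  rcases le_total r s with hrs | hrs
  · have := key (r - i).toNat i j (by omega)
    rwa [show i + ((r - i).toNat : ℤ) = r by omega,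
      show j - ((r - i).toNat : ℤ) = s by omega] at this
  · have := key (s - i).toNat i j (by omega)
    rwa [show i + ((s - i).toNat : ℤ) = s by omega,
      show j - ((s - i).toNat : ℤ) = r by omega, mul_comm (a s)] at this

/-- Sums over a sliding window of fixed length preserve total positivity of order two. -/
theorem IsTP2.windowSum {a : ℤ → ℕ} (ha : IsTP2 a) (d : ℕ) :
    IsTP2 fun k => ∑ m ∈ Finset.range d, a (k - m) := by
  intro i j hij
  cases d with
  | zero => simp
  | succ d =>
    have first : ∀ k : ℤ, ∑ m ∈ Finset.range (d + 1), a (k - m) =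
        a k + ∑ m ∈ Finset.range d, a (k - 1 - m) := by
      intro k
      rw [Finset.sum_range_succ', add_comm]
      congr 1
      · simp
      · exact Finset.sum_congr rfl fun m _ => by congr 1; push_cast; ring
    have last : ∀ k : ℤ, ∑ m ∈ Finset.range (d + 1), a (k - m) =
        ∑ m ∈ Finset.range d, a (k - m) + a (k - d) :=
      fun k => Finset.sum_range_succ _ _
    simp only
    -- With these splittings both sides contain the same product of two sums of length `d`. The
    -- other three terms compare one by one in `h1`, `h2`, `h3`.
    rw [last (i - 1), first (j + 1), first i, last j, show j + 1 - 1 = j by ring]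
    have h1 : a (i - 1 - d) * a (j + 1) ≤ a i * a (j - d) :=
      ha.mul_le_of_nested (by omega) (by omega) (by ring)
    have h2 : (∑ m ∈ Finset.range d, a (i - 1 - m)) * a (j + 1) ≤
        a i * ∑ m ∈ Finset.range d, a (j - m) := by
      rw [Finset.sum_mul, Finset.mul_sum]
      refine Finset.sum_le_sum fun m hm => ?_
      exact ha.mul_le_of_nested (by omega) (by omega) (by ring)
    have h3 : a (i - 1 - d) * (∑ m ∈ Finset.range d, a (j - m)) ≤
        (∑ m ∈ Finset.range d, a (i - 1 - m)) * a (j - d) := by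
      rw [Finset.sum_mul, Finset.mul_sum]
      refine Finset.sum_le_sum fun m hm => ?_
      have := Finset.mem_range.1 hm
      exact ha.mul_le_of_nested (by omega) (by omega) (by ring)
    nlinarith [h1, h2, h3]

/-- The coefficients of a polynomial, extended by zero to negative indices. -/
def intCoeff (p : ℕ[X]) (k : ℤ) : ℕ := if 0 ≤ k then p.coeff k.toNat else 0

theorem intCoeff_natCast (p : ℕ[X]) (k : ℕ) : intCoeff p k = p.coeff k := by
  simp [intCoeff]

theorem isLogConcave_of_isTP2 {p : ℕ[X]} (hp : IsTP2 (intCoeff p)) : IsLogConcave p := by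
  have key : ∀ i r s j : ℕ, i ≤ r → i ≤ s → i + j = r + s →
      p.coeff i * p.coeff j ≤ p.coeff r * p.coeff s := by
    intro i r s j hr hs h
    simp only [← intCoeff_natCast]
    exact hp.mul_le_of_nested (by omega) (by omega) (by omega)
  refine ⟨fun k => ?_, fun i j k hij hjk hi hk hj => ?_⟩
  · rw [sq]
    exact key _ _ _ _ (by omega) (by omega) (by omega)
  -- A zero at `j` would annihilate the inner product and hence the outer one.
  · have := key i j (i + k - j) k hij.le (by omega) (by omega)
    rw [hj, zero_mul, Nat.le_zero] at this
    exact (mul_ne_zero hi hk) this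

theorem isTP2_intCoeff_one : IsTP2 (intCoeff 1) := by
  intro i j hij
  -- Only these indices make both outer factors nonzero, and they violate `i ≤ j`.
  by_cases h : i = 1 ∧ j = -1
  · omega
  · have : intCoeff 1 (i - 1) * intCoeff 1 (j + 1) = 0 := by
      simp only [intCoeff, Polynomial.coeff_one, mul_eq_zero]
      split_ifs <;> omega
    omega

/-- The `q`-integer `1 + q + ⋯ + q ^ (d - 1)`. -/
noncomputable def qInt (d : ℕ) : ℕ[X] := ∑ m ∈ Finset.range d, Polynomial.X ^ m

theorem isTP2_intCoeff_qInt_mul {p : ℕ[X]} (hp : IsTP2 (intCoeff p)) (d : ℕ) :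
    IsTP2 (intCoeff (qInt d * p)) := by
  convert hp.windowSum d using 1
  funext k
  simp only [intCoeff, qInt, Finset.sum_mul, Polynomial.finsetSum_coeff,
    Polynomial.coeff_X_pow_mul']
  split_ifs with hk
  · refine Finset.sum_congr rfl fun m _ => ?_
    split_ifs <;> first | omega | (congr 1; omega)
  · refine (Finset.sum_eq_zero fun m _ => if_neg (by omega)).symm

theorem isTP2_intCoeff_prod_qInt {ι : Type*} (s : Finset ι) (d : ι → ℕ) :
    IsTP2 (intCoeff (∏ i ∈ s, qInt (d i))) := by
  classical
  induction s using Finset.induction_on with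
  | empty => exact isTP2_intCoeff_one
  | insert i s hi ih =>
    rw [Finset.prod_insert hi]
    exact isTP2_intCoeff_qInt_mul ih _

end InvertedTableau

/-! ### Inversion generating functions of permutations with bounded values. -/

namespace InvertedTableau

/-- The number of inversions of a function on the natural numbers, restricted to positions
below `n`. -/
def permInv (n : ℕ) (f : ℕ → ℕ) : ℕ :=
  ((Finset.range n ×ˢ Finset.range n).filter fun p => p.1 < p.2 ∧ f p.2 < f p.1).card

/-- The number of inversions of a permutation of `Fin n`. -/
def finInv {n : ℕ} (f : Fin n → Fin n) : ℕ :=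
  (Finset.univ.filter fun p : Fin n × Fin n => p.1 < p.2 ∧ f p.2 < f p.1).card

/-- The permutation of `Fin (n + 1)` with value `v` at `0` whose other values are in the same
relative order as those of a given permutation. -/
def consPerm {n : ℕ} (v : Fin (n + 1)) (e : Equiv.Perm (Fin n)) : Equiv.Perm (Fin (n + 1)) :=
  ((finSuccEquiv n).trans (Equiv.optionCongr e)).trans (finSuccEquiv' v).symm

@[simp]
theorem consPerm_zero {n : ℕ} (v : Fin (n + 1)) (e : Equiv.Perm (Fin n)) :
    consPerm v e 0 = v := by
  simp [consPerm]

@[simp]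
theorem consPerm_succ {n : ℕ} (v : Fin (n + 1)) (e : Equiv.Perm (Fin n)) (i : Fin n) :
    consPerm v e i.succ = v.succAbove (e i) := by
  simp [consPerm]

theorem consPerm_bijective (n : ℕ) :
    Function.Bijective fun p : Fin (n + 1) × Equiv.Perm (Fin n) => consPerm p.1 p.2 := by
  rw [Fintype.bijective_iff_injective_and_card]
  constructor
  · rintro ⟨v, e⟩ ⟨w, f⟩ h
    have hv : v = w := by simpa using congrArg (fun g => g 0) h
    subst hv
    simp only [Prod.mk.injEq, true_and]
    ext1 i
    have := congrArg (fun g => g i.succ) h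
    simpa using this
  · simp [Fintype.card_perm, Nat.factorial_succ]

/-- Position `0` is inverted with exactly the positions holding one of the `v` smaller values, and
`succAbove` preserves the order of the rest. -/
theorem finInv_consPerm {n : ℕ} (v : Fin (n + 1)) (e : Equiv.Perm (Fin n)) :
    finInv (consPerm v e) = v + finInv e := by
  simp only [finInv, Finset.card_filter, Fintype.sum_prod_type]
  rw [Fin.sum_univ_succ]
  simp only [Fin.sum_univ_succ, consPerm_zero, consPerm_succ, Fin.succ_lt_succ_iff,
    Fin.succAbove_lt_succAbove_iff, Fin.succ_pos, Fin.not_lt_zero, lt_irrefl, true_and,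
    false_and, if_false, zero_add]
  congr 1
  rw [Equiv.sum_comp e (fun x => if v.succAbove x < v then 1 else 0)]
  simp only [Fin.succAbove_lt_iff_castSucc_lt]
  rw [← Finset.card_filter]
  have : (Finset.univ.filter fun x : Fin n => x.castSucc < v).card =
      (Finset.range (v : ℕ)).card := by
    refine Finset.card_bij (fun x _ => (x : ℕ)) ?_ ?_ ?_
    · intro x hx
      simpa [Fin.lt_def] using hx
    · intro x _ y _ h
      exact Fin.ext h
    · intro b hb
      have hb := Finset.mem_range.1 hb
      exact ⟨⟨b, by omega⟩, by simpa [Fin.lt_def] using hb, rfl⟩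
  rw [this, Finset.card_range]

/-- The first value `v < h 0` contributes the factor `[h 0]`. By monotonicity `v` lies below all
later bounds, so deleting it lowers each of them by one whatever `v` is. Truncated subtraction is
harmless: a bound that leaves no choice gives `qInt 0 = 0`. -/
theorem sum_bounded_finPerm (n : ℕ) (h : ℕ → ℕ) (hmono : Monotone h) (hn : ∀ p, h p ≤ n) :
    ∑ e ∈ Finset.univ.filter (fun e : Equiv.Perm (Fin n) => ∀ p : Fin n, (e p : ℕ) < h p),
      (Polynomial.X : ℕ[X]) ^ finInv e = ∏ p ∈ Finset.range n, qInt (h p - p) := by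
  induction n generalizing h with
  | zero => simp [finInv]
  | succ n ih =>
    rw [Finset.sum_filter, ← (consPerm_bijective n).sum_comp, Fintype.sum_prod_type,
      Finset.prod_range_succ']
    have hcond : ∀ (v : Fin (n + 1)) (e : Equiv.Perm (Fin n)),
        (∀ p : Fin (n + 1), (consPerm v e p : ℕ) < h p) ↔
          (v : ℕ) < h 0 ∧ ∀ p : Fin n, (e p : ℕ) < h (p + 1) - 1 := by
      intro v e
      rw [Fin.forall_fin_succ]
      simp only [consPerm_zero, consPerm_succ, Fin.val_zero, Fin.val_succ]
      refine and_congr_right fun hv => forall_congr' fun p => ?_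
      have := hmono (Nat.zero_le ((p : ℕ) + 1))
      rcases lt_or_ge (e p).castSucc v with hlt | hge
      · rw [Fin.succAbove_of_castSucc_lt _ _ hlt]
        have : (e p : ℕ) < v := hlt
        simp only [Fin.val_castSucc]
        omega
      · rw [Fin.succAbove_of_le_castSucc _ _ hge]
        simp only [Fin.val_succ]
        omega
    have ih' := ih (fun p => h (p + 1) - 1)
      (fun a b hab => Nat.sub_le_sub_right (hmono (by omega)) 1)
      (fun p => by have := hn (p + 1); omega)
    have hprod : ∏ p ∈ Finset.range n, qInt (h (p + 1) - (p + 1)) =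
        ∏ p ∈ Finset.range n, qInt (h (p + 1) - 1 - p) :=
      Finset.prod_congr rfl fun p _ => by congr 1; omega
    rw [hprod, ← ih']
    have hinner : ∀ v : Fin (n + 1), (∑ e : Equiv.Perm (Fin n),
        if ∀ p : Fin (n + 1), (consPerm v e p : ℕ) < h p then
          (Polynomial.X : ℕ[X]) ^ finInv (consPerm v e) else 0) =
        (∑ e ∈ Finset.univ.filter
          (fun e : Equiv.Perm (Fin n) => ∀ p : Fin n, (e p : ℕ) < h (p + 1) - 1),
          (Polynomial.X : ℕ[X]) ^ finInv e) *
        (if (v : ℕ) < h 0 then Polynomial.X ^ (v : ℕ) else 0) := by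
      intro v
      rw [Finset.sum_filter, Finset.sum_mul]
      refine Finset.sum_congr rfl fun e _ => ?_
      simp only [hcond, finInv_consPerm]
      by_cases hv : (v : ℕ) < h 0 <;>
        by_cases he : ∀ p : Fin n, (e p : ℕ) < h (p + 1) - 1 <;>
        simp [hv, he, pow_add, mul_comm]
    simp only [hinner]
    rw [← Finset.mul_sum, Nat.sub_zero]
    congr 1
    rw [Fin.sum_univ_eq_sum_range
      (fun v => if v < h 0 then (Polynomial.X : ℕ[X]) ^ v else 0) (n + 1), ← Finset.sum_filter,
      qInt]
    congr 1
    ext x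
    have := hn 0
    simp only [Finset.mem_filter, Finset.mem_range]
    omega

/-! ### Finite permutations inside `Equiv.Perm ℕ`, so that columns of different lengths can be
composed. -/

/-- The permutation of `ℕ` extending a permutation of `Fin n` by the identity. -/
def extendPerm {n : ℕ} (e : Equiv.Perm (Fin n)) : Equiv.Perm ℕ :=
  e.extendDomain Fin.equivSubtype

theorem extendPerm_val {n : ℕ} (e : Equiv.Perm (Fin n)) (i : Fin n) :
    extendPerm e i = e i :=
  Equiv.Perm.extendDomain_apply_image e Fin.equivSubtype i

theorem extendPerm_of_le {n : ℕ} (e : Equiv.Perm (Fin n)) {i : ℕ} (hi : n ≤ i) :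
    extendPerm e i = i :=
  Equiv.Perm.extendDomain_apply_not_subtype e Fin.equivSubtype (by omega)

theorem extendPerm_injective (n : ℕ) :
    Function.Injective (extendPerm : Equiv.Perm (Fin n) → Equiv.Perm ℕ) := by
  intro e f h
  ext i
  rw [← extendPerm_val, ← extendPerm_val, h]

theorem lt_iff_of_fixes {n : ℕ} {s : Equiv.Perm ℕ} (hs : ∀ i, n ≤ i → s i = i) {i : ℕ} :
    s i < n ↔ i < n := by
  constructor
  · intro h
    by_contra hi
    have := hs i (by omega)
    omega
  · intro h
    by_contra hi
    have := s.injective (hs (s i) (by omega))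
    omega

theorem exists_extendPerm_eq {n : ℕ} {s : Equiv.Perm ℕ} (hs : ∀ i, n ≤ i → s i = i) :
    ∃ e : Equiv.Perm (Fin n), extendPerm e = s := by
  have hbij : Function.Bijective fun i : Fin n => (⟨s i, (lt_iff_of_fixes hs).2 i.2⟩ : Fin n) := by
    refine Finite.injective_iff_bijective.1 fun i j h => ?_
    simpa [Fin.ext_iff] using h
  refine ⟨Equiv.ofBijective _ hbij, Equiv.ext fun i => ?_⟩
  rcases lt_or_ge i n with hi | hi
  · exact extendPerm_val (Equiv.ofBijective _ hbij) ⟨i, hi⟩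
  · rw [extendPerm_of_le _ hi, hs i hi]

theorem permInv_extendPerm {n : ℕ} (e : Equiv.Perm (Fin n)) :
    permInv n (extendPerm e) = finInv e := by
  symm
  refine Finset.card_bij (fun p _ => ((p.1 : ℕ), (p.2 : ℕ))) ?_ ?_ ?_
  · rintro ⟨i, j⟩ h
    simpa [extendPerm_val] using h
  · rintro ⟨i, j⟩ _ ⟨i', j'⟩ _ h
    simpa [Fin.ext_iff] using h
  · rintro ⟨i, j⟩ h
    simp only [Finset.mem_filter, Finset.mem_product, Finset.mem_range] at h
    refine ⟨(⟨i, h.1.1⟩, ⟨j, h.1.2⟩), ?_, rfl⟩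
    have h1 := extendPerm_val e ⟨i, h.1.1⟩
    have h2 := extendPerm_val e ⟨j, h.1.2⟩
    simp only at h1 h2
    simp only [Finset.mem_filter, Finset.mem_univ, true_and, Fin.lt_def, ← h1, ← h2]
    exact h.2

open Classical in
/-- The permutations of `ℕ` fixing all `i ≥ n` and satisfying a condition. -/
noncomputable def permsBelow (n : ℕ) (P : Equiv.Perm ℕ → Prop) : Finset (Equiv.Perm ℕ) :=
  ((Finset.univ : Finset (Equiv.Perm (Fin n))).map ⟨extendPerm, extendPerm_injective n⟩).filter P

theorem mem_permsBelow {n : ℕ} {P : Equiv.Perm ℕ → Prop} {s : Equiv.Perm ℕ} :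
    s ∈ permsBelow n P ↔ (∀ i, n ≤ i → s i = i) ∧ P s := by
  simp only [permsBelow, Finset.mem_filter, Finset.mem_map, Finset.mem_univ, true_and,
    Function.Embedding.coeFn_mk]
  refine and_congr_left fun _ => ⟨?_, exists_extendPerm_eq⟩
  rintro ⟨e, rfl⟩ i hi
  exact extendPerm_of_le e hi

theorem sum_permsBelow (n : ℕ) (h : ℕ → ℕ) (hmono : Monotone h) (hn : ∀ p, h p ≤ n)
    {P : Equiv.Perm ℕ → Prop}
    (hP : ∀ s : Equiv.Perm ℕ, (∀ i, n ≤ i → s i = i) → (P s ↔ ∀ p < n, s p < h p)) :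
    ∑ s ∈ permsBelow n P, (Polynomial.X : ℕ[X]) ^ permInv n s =
      ∏ p ∈ Finset.range n, qInt (h p - p) := by
  classical
  rw [← sum_bounded_finPerm n h hmono hn, permsBelow, Finset.sum_filter, Finset.sum_map,
    Finset.sum_filter]
  refine Finset.sum_congr rfl fun e _ => ?_
  simp only [Function.Embedding.coeFn_mk, permInv_extendPerm]
  refine if_congr ?_ rfl rfl
  rw [hP _ fun i hi => extendPerm_of_le e hi]
  constructor
  · intro H p
    rw [← extendPerm_val]
    exact H p p.2
  · intro H p hp
    have := H ⟨p, hp⟩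
    rwa [← extendPerm_val] at this

end InvertedTableau

/-! ### Fillings as column rearrangements of `T`. -/

namespace InvertedTableau

namespace Filling

variable {lam : YoungDiagram}

theorem IsColStandard.entry_lt_iff {T : Filling lam} (hT : T.IsColStandard) {i i' j : ℕ}
    (hi : i < lam.colLen j) (hi' : i' < lam.colLen j) :
    T.entry i j < T.entry i' j ↔ i < i' := by
  rw [← YoungDiagram.mem_iff_lt_colLen] at hi hi'
  rcases lt_trichotomy i i' with h | h | h
  · exact iff_of_true (hT _ _ _ h hi') h
  · subst h; simp
  · exact iff_of_false (hT _ _ _ h hi).asymm h.asymm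

theorem IsColStandard.entry_inj {T : Filling lam} (hT : T.IsColStandard) {i i' j : ℕ}
    (hi : i < lam.colLen j) (hi' : i' < lam.colLen j) :
    T.entry i j = T.entry i' j ↔ i = i' := by
  have h1 := hT.entry_lt_iff hi hi'
  have h2 := hT.entry_lt_iff hi' hi
  omega

/-- The filling obtained by permuting the entries within each column. -/
def permuteCols (T : Filling lam) (σ : ℕ → Equiv.Perm ℕ)
    (hσ : ∀ j i, lam.colLen j ≤ i → σ j i = i) : Filling lam where
  entry i j := T.entry (σ j i) j
  pos := by
    intro i j h
    refine T.pos ?_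
    rw [YoungDiagram.mem_iff_lt_colLen] at h ⊢
    exact (lt_iff_of_fixes (hσ j)).2 h
  no_skip := by
    intro i j v h h1 h2
    have h' : (σ j i, j) ∈ lam := by
      rw [YoungDiagram.mem_iff_lt_colLen] at h ⊢
      exact (lt_iff_of_fixes (hσ j)).2 h
    obtain ⟨i', j', hm, he⟩ := T.no_skip h' h1 h2
    refine ⟨(σ j').symm i', j', ?_, by simpa using he⟩
    rw [YoungDiagram.mem_iff_lt_colLen] at hm ⊢
    rw [← lt_iff_of_fixes (hσ j')]
    simpa using hm
  zeros := by
    intro i j h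
    refine T.zeros ?_
    rw [YoungDiagram.mem_iff_lt_colLen] at h ⊢
    rwa [lt_iff_of_fixes (hσ j)]

/-- The permutation of cells given by permuting the rows within each column. -/
def cellPerm (σ : ℕ → Equiv.Perm ℕ) : Equiv.Perm (ℕ × ℕ) where
  toFun c := (σ c.2 c.1, c.2)
  invFun c := ((σ c.2).symm c.1, c.2)
  left_inv c := by simp
  right_inv c := by simp

theorem cellPerm_mem_iff {σ : ℕ → Equiv.Perm ℕ}
    (hσ : ∀ j i, lam.colLen j ≤ i → σ j i = i) (c : ℕ × ℕ) : cellPerm σ c ∈ lam ↔ c ∈ lam := by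
  obtain ⟨i, j⟩ := c
  simp only [cellPerm, Equiv.coe_fn_mk, YoungDiagram.mem_iff_lt_colLen]
  exact lt_iff_of_fixes (hσ j)

variable {T : Filling lam} {σ : ℕ → Equiv.Perm ℕ}
  {hσ : ∀ j i, lam.colLen j ≤ i → σ j i = i}

theorem content_permuteCols (v : ℕ) : (T.permuteCols σ hσ).content v = T.content v := by
  refine Finset.card_bij (fun c _ => cellPerm σ c) ?_ ?_ ?_
  · intro c hc
    simp only [Finset.mem_filter, YoungDiagram.mem_cells] at hc ⊢
    exact ⟨(cellPerm_mem_iff hσ c).2 hc.1, hc.2⟩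
  · intro a _ b _ h
    exact (cellPerm σ).injective h
  · intro d hd
    refine ⟨(cellPerm σ).symm d, ?_, by simp⟩
    simp only [Finset.mem_filter, YoungDiagram.mem_cells] at hd ⊢
    refine ⟨?_, by simpa [permuteCols, cellPerm] using hd.2⟩
    rw [← cellPerm_mem_iff hσ]
    simpa using hd.1

theorem colEntries_permuteCols (j : ℕ) :
    (T.permuteCols σ hσ).colEntries j = T.colEntries j := by
  have hmap : (lam.col j).map (cellPerm σ).toEmbedding = lam.col j := by
    ext d
    rw [Finset.mem_map_equiv]
    have h := cellPerm_mem_iff hσ ((cellPerm σ).symm d)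
    rw [Equiv.apply_symm_apply] at h
    rw [YoungDiagram.mem_col_iff, YoungDiagram.mem_col_iff, h]
    rfl
  unfold colEntries
  conv_rhs => rw [← hmap, Finset.map_val, Multiset.map_map]
  rfl

theorem isRowStandard_permuteCols :
    (T.permuteCols σ hσ).IsRowStandard ↔ ∀ j, ∀ p < lam.colLen (j + 1),
      T.entry ((σ j * (σ (j + 1))⁻¹) p) j < T.entry p (j + 1) := by
  constructor
  · intro h j p hp
    have hm : ((σ (j + 1))⁻¹ p, j + 1) ∈ lam := by
      rw [YoungDiagram.mem_iff_lt_colLen, ← lt_iff_of_fixes (hσ (j + 1))]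
      simpa using hp
    simpa [permuteCols] using h ((σ (j + 1))⁻¹ p) j (j + 1) (Nat.lt_succ_self j) hm
  · intro h i j j' hj
    induction j', hj using Nat.le_induction with
    | base =>
      intro hm
      rw [YoungDiagram.mem_iff_lt_colLen, ← lt_iff_of_fixes (hσ (j + 1))] at hm
      simpa [permuteCols] using h j _ hm
    | succ j' hj ih =>
      intro hm
      refine (ih (lam.up_left_mem le_rfl (Nat.le_succ j') hm)).trans ?_
      rw [YoungDiagram.mem_iff_lt_colLen, ← lt_iff_of_fixes (hσ (j' + 1))] at hm
      simpa [permuteCols] using h j' _ hm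

/-- Distinctness of entries within a column forces `n = 0`. If a right neighbour is missing, `σ (j +
1)` fixes that row and keeps the rows of column `j + 1` above it, so comparing its values amounts to
comparing rows. -/
theorem isInversionPair_permuteCols (hT : T.IsColStandard) {r s j : ℕ}
    (hr : r < lam.colLen j) (hs : s < lam.colLen j) :
    (T.permuteCols σ hσ).IsInversionPair (r, j) (s, j) ↔
      σ j r < σ j s ∧ σ (j + 1) s < σ (j + 1) r := by
  have lt_iff : ∀ k, r < lam.colLen k → s < lam.colLen k →
      (T.entry (σ k r) k < T.entry (σ k s) k ↔ σ k r < σ k s) := fun k h h' =>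
    hT.entry_lt_iff ((lt_iff_of_fixes (hσ k)).2 h) ((lt_iff_of_fixes (hσ k)).2 h')
  have lt_iff' : ∀ k, r < lam.colLen k → s < lam.colLen k →
      (T.entry (σ k s) k < T.entry (σ k r) k ↔ σ k s < σ k r) := fun k h h' =>
    hT.entry_lt_iff ((lt_iff_of_fixes (hσ k)).2 h') ((lt_iff_of_fixes (hσ k)).2 h)
  simp only [IsInversionPair, permuteCols, YoungDiagram.mem_iff_lt_colLen, hr, hs, true_and]
  rw [lt_iff j hr hs]
  refine and_congr_right fun hrs => ?_
  have hne : r ≠ s := by rintro rfl; exact lt_irrefl _ hrs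
  have hr1 := lt_iff_of_fixes (hσ (j + 1)) (i := r)
  have hs1 := lt_iff_of_fixes (hσ (j + 1)) (i := s)
  have hr2 := hσ (j + 1) r
  have hs2 := hσ (j + 1) s
  have step : ((¬ r < lam.colLen (j + 1) ∨ ¬ s < lam.colLen (j + 1)) ∧ s < r ∨
      r < lam.colLen (j + 1) ∧ s < lam.colLen (j + 1) ∧
        T.entry (σ (j + 1) s) (j + 1) < T.entry (σ (j + 1) r) (j + 1)) ↔
      σ (j + 1) s < σ (j + 1) r := by
    by_cases h1 : r < lam.colLen (j + 1) <;> by_cases h2 : s < lam.colLen (j + 1)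
    · simp [h1, h2, lt_iff' _ h1 h2]
    all_goals
      simp only [h1, h2, not_true, not_false_iff, or_true, true_and, false_and, or_false,
        and_false]
      omega
  rw [← step]
  constructor
  · rintro ⟨n, hn, h⟩
    rcases Nat.eq_zero_or_pos n with rfl | hpos
    · simpa using h
    · exfalso
      obtain ⟨h1, h2, h3⟩ := hn 1 (Finset.mem_Icc.2 ⟨le_rfl, hpos⟩)
      rw [hT.entry_inj ((lt_iff_of_fixes (hσ (j + 1))).2 h1)
        ((lt_iff_of_fixes (hσ (j + 1))).2 h2)] at h3
      exact hne ((σ (j + 1)).injective h3)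
  · intro h
    exact ⟨0, by simp, by simpa using h⟩

theorem inv_permuteCols (hT : T.IsColStandard) {L : ℕ} (hL : lam.colLen L = 0) :
    (T.permuteCols σ hσ).inv =
      ∑ j ∈ Finset.range L, permInv (lam.colLen j) (σ j * (σ (j + 1))⁻¹ : Equiv.Perm ℕ) := by
  classical
  unfold inv
  rw [Finset.card_eq_sum_card_fiberwise (f := fun p => p.1.2) (t := Finset.range L)]
  · refine Finset.sum_congr rfl fun j _ => ?_
    have hmono : lam.colLen (j + 1) ≤ lam.colLen j := lam.colLen_anti _ _ (Nat.le_succ j)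
    have hσ' : ∀ i, lam.colLen j ≤ i → σ (j + 1) i = i :=
      fun i hi => hσ (j + 1) i (hmono.trans hi)
    -- The cells are swapped: the larger entry of column `j` comes at the earlier position of the
    -- relative permutation.
    refine Finset.card_bij (fun p _ => (σ (j + 1) p.2.1, σ (j + 1) p.1.1)) ?_ ?_ ?_
    · rintro ⟨⟨r, j1⟩, ⟨s, j2⟩⟩ h
      simp only [Finset.mem_filter, Finset.mem_product, YoungDiagram.mem_cells] at h
      obtain ⟨⟨⟨hc, hd⟩, hinv⟩, rfl⟩ := h
      have hj : j1 = j2 := hinv.2.2.1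
      subst hj
      rw [YoungDiagram.mem_iff_lt_colLen] at hc hd
      rw [isInversionPair_permuteCols hT hc hd] at hinv
      simp only [Finset.mem_filter, Finset.mem_product, Finset.mem_range, lt_iff_of_fixes hσ']
      exact ⟨⟨hd, hc⟩, hinv.2, by simpa using hinv.1⟩
    · rintro ⟨⟨r, j1⟩, ⟨s, j2⟩⟩ h ⟨⟨r', j1'⟩, ⟨s', j2'⟩⟩ h' he
      simp only [Finset.mem_filter] at h h'
      have h2 : j1 = j2 := h.1.2.2.2.1
      have h2' : j1' = j2' := h'.1.2.2.2.1
      have h3 := h.2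
      have h3' := h'.2
      simp only [Prod.mk.injEq, EmbeddingLike.apply_eq_iff_eq] at he
      simp only [Prod.mk.injEq]
      omega
    · rintro ⟨p, q⟩ h
      simp only [Finset.mem_filter, Finset.mem_product, Finset.mem_range] at h
      obtain ⟨⟨hp, hq⟩, hpq, hinv⟩ := h
      have hp' : (σ (j + 1))⁻¹ p < lam.colLen j := by
        rw [← lt_iff_of_fixes hσ']; simpa using hp
      have hq' : (σ (j + 1))⁻¹ q < lam.colLen j := by
        rw [← lt_iff_of_fixes hσ']; simpa using hq
      refine ⟨(((σ (j + 1))⁻¹ q, j), ((σ (j + 1))⁻¹ p, j)), ?_, by simp⟩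
      simp only [Finset.mem_filter, Finset.mem_product, YoungDiagram.mem_cells, and_true]
      refine ⟨?_, ?_⟩
      · simp only [YoungDiagram.mem_iff_lt_colLen]
        exact ⟨hq', hp'⟩
      · rw [isInversionPair_permuteCols hT hq' hp']
        simpa using ⟨hinv, hpq⟩
  · rintro ⟨⟨r, j⟩, d⟩ h
    simp only [Finset.mem_coe, Finset.mem_filter, Finset.mem_product, YoungDiagram.mem_cells,
      YoungDiagram.mem_iff_lt_colLen] at h
    simp only [Finset.coe_range, Set.mem_Iio]
    by_contra hj
    have h1 := h.1.1
    have := lam.colLen_anti L j (by omega)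
    omega

theorem permuteCols_injective (hT : T.IsColStandard) {τ : ℕ → Equiv.Perm ℕ}
    {hτ : ∀ j i, lam.colLen j ≤ i → τ j i = i}
    (h : T.permuteCols σ hσ = T.permuteCols τ hτ) : σ = τ := by
  funext j
  ext i
  rcases lt_or_ge i (lam.colLen j) with hi | hi
  · have := congrFun (congrFun (congrArg Filling.entry h) i) j
    exact (hT.entry_inj ((lt_iff_of_fixes (hσ j)).2 hi)
      ((lt_iff_of_fixes (hτ j)).2 hi)).1 this
  · rw [hσ j i hi, hτ j i hi]

theorem HasStandardization.exists_permuteCols {t : Filling lam} (h : t.HasStandardization T) :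
    ∃ (σ : ℕ → Equiv.Perm ℕ) (hσ : ∀ j i, lam.colLen j ≤ i → σ j i = i),
      t = T.permuteCols σ hσ := by
  obtain ⟨hT, hcol⟩ := h
  have mem_col : ∀ {i j}, i < lam.colLen j → (i, j) ∈ lam.col j := fun hi =>
    YoungDiagram.mk_mem_col_iff.2 (YoungDiagram.mem_iff_lt_colLen.2 hi)
  have hnodup : ∀ j, (T.colEntries j).Nodup := by
    intro j
    refine Multiset.Nodup.map_on ?_ (lam.col j).nodup
    rintro ⟨i, j1⟩ h1 ⟨i', j2⟩ h2 he
    obtain ⟨hm1, hj1⟩ := YoungDiagram.mem_col_iff.1 h1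
    obtain ⟨hm2, hj2⟩ := YoungDiagram.mem_col_iff.1 h2
    simp only at hj1 hj2
    subst hj1 hj2
    rw [YoungDiagram.mem_iff_lt_colLen] at hm1 hm2
    rw [(hT.entry_inj hm1 hm2).1 he]
  have hex : ∀ j, ∀ i : Fin (lam.colLen j), ∃ i' : Fin (lam.colLen j),
      T.entry i' j = t.entry i j := by
    intro j i
    have hm : t.entry i j ∈ t.colEntries j := Multiset.mem_map.2 ⟨(i, j), mem_col i.2, rfl⟩
    rw [hcol j] at hm
    obtain ⟨⟨i', j'⟩, hd, he⟩ := Multiset.mem_map.1 hm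
    obtain ⟨hm', hj⟩ := YoungDiagram.mem_col_iff.1 hd
    simp only at hj
    subst hj
    exact ⟨⟨i', YoungDiagram.mem_iff_lt_colLen.1 hm'⟩, he⟩
  choose f hf using hex
  have hbij : ∀ j, Function.Bijective (f j) := by
    intro j
    refine Finite.injective_iff_bijective.1 fun a b hab => ?_
    have he : t.entry a j = t.entry b j := by rw [← hf, ← hf, hab]
    have hn := hnodup j
    rw [← hcol j] at hn
    have := Multiset.inj_on_of_nodup_map hn (a, j) (mem_col a.2) (b, j) (mem_col b.2) he
    simpa [Fin.ext_iff] using this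
  refine ⟨fun j => extendPerm (Equiv.ofBijective (f j) (hbij j)),
    fun j i hi => extendPerm_of_le _ hi, ?_⟩
  ext i j
  rcases lt_or_ge i (lam.colLen j) with hi | hi
  · have := extendPerm_val (Equiv.ofBijective (f j) (hbij j)) ⟨i, hi⟩
    simp only [Equiv.ofBijective_apply] at this
    simp only [permuteCols, this]
    exact (hf j ⟨i, hi⟩).symm
  · have hm : (i, j) ∉ lam := by
      rw [YoungDiagram.mem_iff_lt_colLen]; omega
    rw [Filling.zeros _ hm, Filling.zeros _ hm]

end Filling

/-! ### Recovering column permutations from relative ones. -/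

/-- The product `f j * f (j + 1) * ⋯ * f (L - 1)`. -/
def tailProd {M : Type*} [Monoid M] (L : ℕ) (f : ℕ → M) (j : ℕ) : M :=
  ((List.range' j (L - j)).map f).prod

theorem tailProd_of_le {M : Type*} [Monoid M] {L : ℕ} (f : ℕ → M) {j : ℕ} (h : L ≤ j) :
    tailProd L f j = 1 := by
  simp [tailProd, Nat.sub_eq_zero_of_le h]

theorem tailProd_of_lt {M : Type*} [Monoid M] {L : ℕ} (f : ℕ → M) {j : ℕ} (h : j < L) :
    tailProd L f j = f j * tailProd L f (j + 1) := by
  rw [tailProd, tailProd, show L - j = L - (j + 1) + 1 by omega, List.range'_succ]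
  simp

/-- The product of successive ratios telescopes, and `g` is trivial from `L` on. -/
theorem eq_tailProd {G : Type*} [Group G] {L : ℕ} {f g : ℕ → G}
    (hg : ∀ j, L ≤ j → g j = 1) (hf : ∀ j < L, f j = g j * (g (j + 1))⁻¹) :
    tailProd L f = g := by
  have key : ∀ k j, L - j = k → tailProd L f j = g j := by
    intro k
    induction k with
    | zero => intro j hj; rw [tailProd_of_le f (by omega), hg j (by omega)]
    | succ k ih =>
      intro j hj
      rw [tailProd_of_lt f (by omega), hf j (by omega), ih (j + 1) (by omega)]
      simp
  exact funext fun j => key _ j rfl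

theorem tailProd_fixes {L : ℕ} {f : ℕ → Equiv.Perm ℕ} {n : ℕ → ℕ} (hn : Antitone n)
    (hf : ∀ j < L, ∀ i, n j ≤ i → f j i = i) (j i : ℕ) (hi : n j ≤ i) :
    tailProd L f j i = i := by
  have key : ∀ k j, L - j = k → n j ≤ i → tailProd L f j i = i := by
    intro k
    induction k with
    | zero => intro j hj _; rw [tailProd_of_le f (by omega)]; rfl
    | succ k ih =>
      intro j hj hi
      rw [tailProd_of_lt f (by omega), Equiv.Perm.mul_apply,
        ih (j + 1) (by omega) ((hn (Nat.le_succ j)).trans hi), hf j (by omega) i hi]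
  exact key _ j rfl hi

/-- Extend a finite sequence by `1`. -/
def extendOne {M : Type*} [One M] {L : ℕ} (x : Fin L → M) (j : ℕ) : M :=
  if h : j < L then x ⟨j, h⟩ else 1

theorem extendOne_val {M : Type*} [One M] {L : ℕ} (x : Fin L → M) (j : Fin L) :
    extendOne x j = x j := by
  simp [extendOne]

/-! ### Factorisation of the generating function over columns. -/

section Chi

variable {lam : YoungDiagram}

/-- The relative permutations of columns `j` and `j + 1` for which rows increase. -/
noncomputable def rowPerms (T : Filling lam) (j : ℕ) : Finset (Equiv.Perm ℕ) :=
  permsBelow (lam.colLen j) fun s =>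
    ∀ p < lam.colLen (j + 1), T.entry (s p) j < T.entry p (j + 1)

/-- Columns from `L` on are empty, so tail products turn an arbitrary admissible tuple of relative
permutations into a unique filling. -/
theorem ncard_invertedTableauxOver {T : Filling lam} (hT : T.IsStandardTableau) {L : ℕ}
    (hL : lam.colLen L = 0) (k : ℕ) :
    (invertedTableauxOver T k).ncard =
      ((Fintype.piFinset fun j : Fin L => rowPerms T j).filter
        fun x => ∑ j : Fin L, permInv (lam.colLen j) (x j) = k).card := by
  obtain ⟨-, hcol, hcont⟩ := hT
  have colLen_eq : ∀ j, L ≤ j → lam.colLen j = 0 := fun j hj =>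
    Nat.le_zero.1 ((lam.colLen_anti _ _ hj).trans hL.le)
  have fixes : ∀ x ∈ Fintype.piFinset (fun j : Fin L => rowPerms T j), ∀ j i,
      lam.colLen j ≤ i → tailProd L (extendOne x) j i = i := by
    intro x hx
    refine tailProd_fixes (fun a b h => lam.colLen_anti _ _ h) fun j hj => ?_
    have := (mem_permsBelow.1 (Fintype.mem_piFinset.1 hx ⟨j, hj⟩)).1
    rwa [← extendOne_val x] at this
  have ratio : ∀ x : Fin L → Equiv.Perm ℕ, ∀ j : Fin L,
      tailProd L (extendOne x) j * (tailProd L (extendOne x) (j + 1))⁻¹ = x j := by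
    intro x j
    rw [tailProd_of_lt _ j.2, extendOne_val, mul_inv_cancel_right]
  rw [← Set.ncard_coe_finset]
  symm
  refine Set.ncard_congr (fun x hx => T.permuteCols (tailProd L (extendOne x))
    (fixes x (Finset.mem_filter.1 hx).1)) ?_ ?_ ?_
  · intro x hx
    obtain ⟨hx, hk⟩ := Finset.mem_filter.1 hx
    refine ⟨⟨?_, ?_, ?_⟩, hcol, Filling.colEntries_permuteCols⟩
    · rw [Filling.isRowStandard_permuteCols]
      intro j p hp
      have hj : j < L := by
        by_contra hj
        rw [colLen_eq (j + 1) (by omega)] at hp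
        omega
      rw [ratio x ⟨j, hj⟩]
      exact (mem_permsBelow.1 (Fintype.mem_piFinset.1 hx ⟨j, hj⟩)).2 p hp
    · intro v hv
      rw [Filling.content_permuteCols, hcont v hv]
    · rw [Filling.inv_permuteCols hcol hL, ← hk, Finset.sum_range]
      simp only [ratio]
  · intro x y hx hy h
    have := Filling.permuteCols_injective hcol h
    funext j
    rw [← ratio x, ← ratio y, this]
  · rintro t ⟨⟨hrow, -, hk⟩, hst⟩
    obtain ⟨σ, hσ, rfl⟩ := hst.exists_permuteCols
    have hone : ∀ j, L ≤ j → σ j = 1 := by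
      intro j hj
      ext i
      exact hσ j i (by rw [colLen_eq j hj]; omega)
    have htail : tailProd L (extendOne fun j : Fin L => σ j * (σ (j + 1))⁻¹) = σ :=
      eq_tailProd hone fun j hj => extendOne_val _ (⟨j, hj⟩ : Fin L)
    refine ⟨fun j : Fin L => σ j * (σ (j + 1))⁻¹, ?_, ?_⟩
    · rw [Finset.mem_coe, Finset.mem_filter, Fintype.mem_piFinset]
      refine ⟨fun j => mem_permsBelow.2 ⟨fun i hi => ?_, ?_⟩, ?_⟩
      · have : (σ (j + 1))⁻¹ i = i := by
          rw [Equiv.Perm.inv_eq_iff_eq]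
          exact (hσ _ i ((lam.colLen_anti _ _ (Nat.le_succ _)).trans hi)).symm
        rw [Equiv.Perm.mul_apply, this, hσ _ i hi]
      · exact Filling.isRowStandard_permuteCols.1 hrow j
      · rw [← hk, Filling.inv_permuteCols hcol hL, Finset.sum_range]
    · simp only [htail]

theorem chi_eq_prod_sum {T : Filling lam} (hT : T.IsStandardTableau) {L : ℕ}
    (hL : lam.colLen L = 0) :
    chi T = ∏ j : Fin L, ∑ s ∈ rowPerms T j, (Polynomial.X : ℕ[X]) ^ permInv (lam.colLen j) s := by
  rw [Finset.prod_univ_sum]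
  ext k
  rw [coeff_chi, ncard_invertedTableauxOver hT hL, Polynomial.finsetSum_coeff,
    Finset.card_filter]
  refine Finset.sum_congr rfl fun x _ => ?_
  rw [Finset.prod_pow_eq_pow_sum, Polynomial.coeff_X_pow]
  exact if_congr eq_comm rfl rfl

theorem lt_card_filter_range_iff {n i : ℕ} {Q : ℕ → Prop} [DecidablePred Q]
    (hQ : ∀ a b, a ≤ b → b < n → Q b → Q a) (hi : i < n) :
    i < ((Finset.range n).filter Q).card ↔ Q i := by
  constructor
  · intro h
    by_contra hQi
    have hsub : (Finset.range n).filter Q ⊆ Finset.range i := by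
      intro b hb
      obtain ⟨hb, hQb⟩ := Finset.mem_filter.1 hb
      by_contra hbi
      rw [Finset.mem_range] at hb hbi
      exact hQi (hQ i b (by omega) hb hQb)
    have := Finset.card_le_card hsub
    rw [Finset.card_range] at this
    omega
  · intro h
    have hsub : Finset.range (i + 1) ⊆ (Finset.range n).filter Q := by
      intro a ha
      rw [Finset.mem_range] at ha
      exact Finset.mem_filter.2 ⟨Finset.mem_range.2 (by omega), hQ a i (by omega) hi h⟩
    have := Finset.card_le_card hsub
    rw [Finset.card_range] at this
    omega

theorem exists_sum_rowPerms_eq_prod_qInt {T : Filling lam} (hT : T.IsColStandard) (j : ℕ) :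
    ∃ d : ℕ → ℕ, ∑ s ∈ rowPerms T j, (Polynomial.X : ℕ[X]) ^ permInv (lam.colLen j) s =
      ∏ p ∈ Finset.range (lam.colLen j), qInt (d p) := by
  have hle : lam.colLen (j + 1) ≤ lam.colLen j := lam.colLen_anti _ _ (Nat.le_succ j)
  -- Column `j` increases, so its entries below a given one fill an initial segment of rows, and the
  -- row condition becomes a bound on `s p`. Rows without a right neighbour are unconstrained.
  let h : ℕ → ℕ := fun p => if p < lam.colLen (j + 1) then
    ((Finset.range (lam.colLen j)).filter fun i => T.entry i j < T.entry p (j + 1)).card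
    else lam.colLen j
  have hn : ∀ p, h p ≤ lam.colLen j := by
    intro p
    simp only [h]
    split_ifs
    · exact (Finset.card_filter_le _ _).trans (Finset.card_range _).le
    · exact le_rfl
  have hmono : Monotone h := by
    intro p q hpq
    by_cases hq : q < lam.colLen (j + 1)
    · have hp : p < lam.colLen (j + 1) := by omega
      simp only [h, hp, hq, if_true]
      refine Finset.card_le_card (Finset.monotone_filter_right _ fun i _ hi => hi.trans_le ?_)
      rcases hpq.eq_or_lt with rfl | hlt
      · exact le_rfl
      · exact ((hT.entry_lt_iff hp hq).2 hlt).le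
    · have : h q = lam.colLen j := if_neg hq
      rw [this]
      exact hn p
  refine ⟨fun p => h p - p, sum_permsBelow _ h hmono hn fun s hs => ?_⟩
  have hiff : ∀ p < lam.colLen (j + 1),
      (T.entry (s p) j < T.entry p (j + 1) ↔ s p < h p) := by
    intro p hp
    simp only [h, hp, if_true]
    refine (lt_card_filter_range_iff (Q := fun i => T.entry i j < T.entry p (j + 1)) ?_
      ((lt_iff_of_fixes hs).2 (hp.trans_le hle))).symm
    intro a b hab hb hlt
    rcases hab.eq_or_lt with rfl | hab
    · exact hlt
    · exact ((hT.entry_lt_iff (hab.trans hb) hb).2 hab).trans hlt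
  constructor
  · intro H p hp
    by_cases hp' : p < lam.colLen (j + 1)
    · exact (hiff p hp').1 (H p hp')
    · simp only [h, hp', if_false]
      exact (lt_iff_of_fixes hs).2 hp
  · intro H p hp
    exact (hiff p hp).2 (H p (hp.trans_le hle))

end Chi

end InvertedTableau

theorem mainTheorem11 (lam : YoungDiagram) (T : InvertedTableau.Filling lam)
    (hT : T.IsStandardTableau) :
    InvertedTableau.IsLogConcave (InvertedTableau.chi T) := by
  -- The length of the top row is the index of the first empty column.
  have hL : lam.colLen (lam.rowLen 0) = 0 := by
    by_contra h
    have h1 : (0, lam.rowLen 0) ∈ lam := YoungDiagram.mem_iff_lt_colLen.2 (Nat.pos_of_ne_zero h)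
    exact lt_irrefl _ (YoungDiagram.mem_iff_lt_rowLen.1 h1)
  choose d hd using InvertedTableau.exists_sum_rowPerms_eq_prod_qInt hT.2.1
  apply InvertedTableau.isLogConcave_of_isTP2
  rw [InvertedTableau.chi_eq_prod_sum hT hL]
  simp only [hd]
  rw [Finset.prod_sigma']
  exact InvertedTableau.isTP2_intCoeff_prod_qInt _ _
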